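/- **Definitions.** A Smale space $(X,\varphi)$ is a compact metric space $X$ with a homeomorphism $\varphi$ for which there are constants $\varepsilon_X>0$, $0<\lambda<1$ and a continuous bracket $[\cdot,\cdot]:\{(x,y): d(x,y)\le\varepsilon_X\}\to X$ such that $[x,x]=x$, $[x,[y,z]]=[x,z]$, $[[x,y],z]=[x,z]$, $\varphi[x,y]=[\varphi(x),\varphi(y)]$ whenever both sides are defined, $d(\varphi(x),\varphi(y))\le\lambda d(x,y)$ if $[x,y]=y$, and $d(\varphi^{-1}(x),\varphi^{-1}(y))\le\lambda d(x,y)$ if $[x,y]=x$. Put $X^s(x)=\{y: \lim_{n\to\infty}d(\varphi^n(x),\varphi^n(y))=0\}$ and $X^u(x)=\{y:\lim_{n\to\infty}d(\varphi^{-n}(x),\varphi^{-n}(y))=0\}$. A continuous map $\pi:X\to Y$ with $\pi\circ\varphi=\psi\circ\pi$ between Smale spaces $(X,\varphi)$ and $(Y,\psi)$ is s-bijective (u-bijective) if for every $x\in X$ it restricts to a bijection $X^s(x)\to Y^s(\pi(x))$ (respectively $X^u(x)\to Y^u(\pi(x))$). A conjugacy is a homeomorphism intertwining the dynamics. A correspondence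 from $(X,\varphi)$ to $(Y,\psi)$ is a Smale space $(M,\mu)$ with a u-bijective map $\pi_u:M\to X$ and an s-bijective map $\pi_s:M\to Y$. Its composition with a correspondence $Y\xleftarrow{\pi_u'}M'\xrightarrow{\pi_s'}Z$ is $X\xleftarrow{\pi_u\circ P_1}\{(m,m')\in M\times M':\pi_s(m)=\pi_u'(m')\}\xrightarrow{\pi_s'\circ P_2}Z$ with the dynamics $\mu\times\mu'$, where $P_1,P_2$ are the coordinate projections. Two such diagrams $X\leftarrow M_1\to Y$ and $X\leftarrow M_2\to Y$ are isomorphic if there is a conjugacy $M_1\to M_2$ commuting with the maps to $X$ and to $Y$. $(X,\varphi)$ and $(Y,\psi)$ are strongly equivalent if there are a correspondence from $X$ to $Y$ and a correspondence from $Y$ to $X$ whose compositions in the two orders are isomorphic to the identity correspondences $X\xleftarrow{\mathrm{id}}X\xrightarrow{\mathrm{id}}X$ and $Y\xleftarrow{\mathrm{id}}Y\xrightarrow{\mathrm{id}}Y$. For a finite directed graph $G$ with no sources and no sinks, $A_G$ is its adjacency matrix and $(\Sigma_G,\sigma)$ the space of bi-infinite edge paths in $G$ with the shift map. A Smale space is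 a shift of finite type if it is conjugate to $(\Sigma_G,\sigma)$ for some such $G$; we then say that $G$ presents it. Square nonnegative integer matrices $A,B$ are strong shift equivalent if there is a finite chain $A=A_0,A_1,\dots,A_\ell=B$ ($\ell\ge1$) of square nonnegative integer matrices and, for each $k$, rectangular nonnegative integer matrices $R_k,S_k$ with $A_{k-1}=R_kS_k$ and $A_k=S_kR_k$. **Statement.** Let $(\Sigma,\sigma)$ be a shift of finite type, presented by the graph $G$, and let $(X,\varphi)$ be a Smale space. Then $(\Sigma,\sigma)$ is strongly equivalent to $(X,\varphi)$ if and only if $(X,\varphi)$ is a shift of finite type and $(\Sigma,\sigma)$ and $(X,\varphi)$ are strong shift equivalent. Here the last condition may be read in either of two ways, and the equivalence holds with both: $A_G$ is strong shift equivalent to $A_H$ for every graph $H$ presenting $(X,\varphi)$; or $A_G$ is strong shift equivalent to $A_H$ for some graph $H$ presenting $(X,\varphi)$. -/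

import Mathlib

open Filter Topology Set

universe u

/-! ### Smale spaces -/

/-- The homeomorphism `φ` of the compact metric space `X` makes it a Smale space: there are
constants `ε > 0`, `0 < lam < 1` and a bracket, continuous on the set of pairs at distance at
most `ε`, satisfying the bracket axioms whenever both sides are defined and the contraction axioms.
The bracket is a total function whose values on pairs at distance more than `ε` are never used. -/
def IsSmaleSpace {X : Type u} [MetricSpace X] [CompactSpace X] (φ : X ≃ₜ X) : Prop :=
  ∃ (ε lam : ℝ) (br : X → X → X),
    0 < ε ∧ 0 < lam ∧ lam < 1 ∧
    ContinuousOn (fun p : X × X => br p.1 p.2) {p | dist p.1 p.2 ≤ ε} ∧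
    (∀ x, br x x = x) ∧
    (∀ x y z, dist y z ≤ ε → dist x (br y z) ≤ ε → dist x z ≤ ε →
      br x (br y z) = br x z) ∧
    (∀ x y z, dist x y ≤ ε → dist (br x y) z ≤ ε → dist x z ≤ ε →
      br (br x y) z = br x z) ∧
    (∀ x y, dist x y ≤ ε → dist (φ x) (φ y) ≤ ε → φ (br x y) = br (φ x) (φ y)) ∧
    (∀ x y, dist x y ≤ ε → br x y = y → dist (φ x) (φ y) ≤ lam * dist x y) ∧
    (∀ x y, dist x y ≤ ε → br x y = x → dist (φ.symm x) (φ.symm y) ≤ lam * dist x y)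

/-- A Smale space `(X, φ)`. -/
structure SmaleSpace : Type (u + 1) where
  carrier : Type u
  [metric : MetricSpace carrier]
  [compact : CompactSpace carrier]
  φ : carrier ≃ₜ carrier
  isSmale : IsSmaleSpace φ

instance : CoeSort SmaleSpace.{u} (Type u) := ⟨SmaleSpace.carrier⟩

instance (X : SmaleSpace.{u}) : MetricSpace X := X.metric

instance (X : SmaleSpace.{u}) : CompactSpace X := X.compact

/-- The global stable set of `x`. -/
def SmaleSpace.stableSet (X : SmaleSpace.{u}) (x : X) : Set X :=
  {y | Tendsto (fun n : ℕ => dist (X.φ^[n] x) (X.φ^[n] y)) atTop (𝓝 0)}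

/-- The global unstable set of `x`. -/
def SmaleSpace.unstableSet (X : SmaleSpace.{u}) (x : X) : Set X :=
  {y | Tendsto (fun n : ℕ => dist (X.φ.symm^[n] x) (X.φ.symm^[n] y)) atTop (𝓝 0)}

/-- A map of Smale spaces: a continuous function intertwining the dynamics. -/
def IsSmaleMap {X Y : SmaleSpace.{u}} (π : X → Y) : Prop :=
  Continuous π ∧ ∀ x, π (X.φ x) = Y.φ (π x)

/-- An s-bijective map: it restricts to a bijection from each stable set `X^s(x)` onto
`Y^s(π x)`. -/
def IsSBijective {X Y : SmaleSpace.{u}} (π : X → Y) : Prop :=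
  IsSmaleMap π ∧ ∀ x, BijOn π (X.stableSet x) (Y.stableSet (π x))

/-- A u-bijective map: it restricts to a bijection from each unstable set `X^u(x)` onto
`Y^u(π x)`. -/
def IsUBijective {X Y : SmaleSpace.{u}} (π : X → Y) : Prop :=
  IsSmaleMap π ∧ ∀ x, BijOn π (X.unstableSet x) (Y.unstableSet (π x))

/-- Two homeomorphisms are conjugate. -/
def Conjugate {X Y : Type*} [TopologicalSpace X] [TopologicalSpace Y]
    (φ : X ≃ₜ X) (ψ : Y ≃ₜ Y) : Prop :=
  ∃ Θ : X ≃ₜ Y, ∀ x, Θ (φ x) = ψ (Θ x)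

/-! ### Correspondences -/

/-- A diagram `X ← M → Y` of topological dynamical systems: `M` is a topological space with a
homeomorphism `μ`, and the legs are continuous and intertwine the dynamics. This is the part of a
correspondence that the notion of isomorphism refers to. -/
structure DynSpan (X Y : SmaleSpace.{u}) where
  carrier : Type u
  [top : TopologicalSpace carrier]
  μ : carrier ≃ₜ carrier
  left : carrier → X
  right : carrier → Y
  left_map : Continuous left ∧ ∀ m, left (μ m) = X.φ (left m)
  right_map : Continuous right ∧ ∀ m, right (μ m) = Y.φ (right m)

instance {X Y : SmaleSpace.{u}} (M : DynSpan X Y) : TopologicalSpace M.carrier := M.top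

/-- Two diagrams `X ← M₁ → Y` and `X ← M₂ → Y` are isomorphic if there is a conjugacy
`M₁ → M₂` commuting with the legs. -/
def DynSpan.Isomorphic {X Y : SmaleSpace.{u}} (M₁ M₂ : DynSpan X Y) : Prop :=
  ∃ Θ : M₁.carrier ≃ₜ M₂.carrier, (∀ m, Θ (M₁.μ m) = M₂.μ (Θ m)) ∧
    (∀ m, M₂.left (Θ m) = M₁.left m) ∧ (∀ m, M₂.right (Θ m) = M₁.right m)

/-- A correspondence from `X` to `Y`: a Smale space `M` with a u-bijective map `M → X` and an
s-bijective map `M → Y`. (Surjectivity of these two maps is automatic when the correspondence is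
strongly invertible, the only case used here.) -/
structure Correspondence (X Y : SmaleSpace.{u}) where
  M : SmaleSpace.{u}
  πu : M → X
  πs : M → Y
  u_bij : IsUBijective πu
  s_bij : IsSBijective πs

/-- The diagram underlying a correspondence. -/
def Correspondence.toSpan {X Y : SmaleSpace.{u}} (C : Correspondence X Y) : DynSpan X Y where
  carrier := C.M
  μ := C.M.φ
  left := C.πu
  right := C.πs
  left_map := C.u_bij.1
  right_map := C.s_bij.1

/-- The identity correspondence `X ← X → X`. -/
def Correspondence.refl (X : SmaleSpace.{u}) : Correspondence X X where
  M := X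
  πu := id
  πs := id
  u_bij := ⟨⟨continuous_id, fun _ => rfl⟩, fun _ => bijOn_id _⟩
  s_bij := ⟨⟨continuous_id, fun _ => rfl⟩, fun _ => bijOn_id _⟩

/-- The composition of correspondences `X ← M → Y` and `Y ← M' → Z`: the fibre product
`{(m, m') | πs m = πu' m'}` with the product dynamics and the legs `πu ∘ P₁`, `πs' ∘ P₂`. -/
def Correspondence.comp {X Y Z : SmaleSpace.{u}} (C : Correspondence X Y)
    (C' : Correspondence Y Z) : DynSpan X Z where
  carrier := {p : C.M × C'.M // C.πs p.1 = C'.πu p.2}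
  μ := (C.M.φ.prodCongr C'.M.φ).subtype (fun p => by
    change C.πs p.1 = C'.πu p.2 ↔ C.πs (C.M.φ p.1) = C'.πu (C'.M.φ p.2)
    rw [C.s_bij.1.2, C'.u_bij.1.2, Y.φ.injective.eq_iff])
  left := fun p => C.πu p.1.1
  right := fun p => C'.πs p.1.2
  left_map := ⟨C.u_bij.1.1.comp (continuous_fst.comp continuous_subtype_val),
    fun p => C.u_bij.1.2 p.1.1⟩
  right_map := ⟨C'.s_bij.1.1.comp (continuous_snd.comp continuous_subtype_val),
    fun p => C'.s_bij.1.2 p.1.2⟩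

/-- A correspondence is strongly invertible if some correspondence in the other direction is its
inverse, in both orders, up to isomorphism. -/
def Correspondence.StronglyInvertible {X Y : SmaleSpace.{u}} (C : Correspondence X Y) : Prop :=
  ∃ C' : Correspondence Y X,
    (C.comp C').Isomorphic (Correspondence.refl X).toSpan ∧
    (C'.comp C).Isomorphic (Correspondence.refl Y).toSpan

/-- Strong equivalence of Smale spaces. -/
def StronglyEquivalent (X Y : SmaleSpace.{u}) : Prop :=
  ∃ C : Correspondence X Y, C.StronglyInvertible

/-! ### Shifts of finite type -/

/-- A finite directed graph with no sources and no sinks. -/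
structure FinGraph where
  V : Type
  E : Type
  [finV : Fintype V]
  [finE : Fintype E]
  i : E → V
  t : E → V
  no_source : ∀ v, ∃ e, t e = v
  no_sink : ∀ v, ∃ e, i e = v

namespace FinGraph

variable (G : FinGraph)

instance : Fintype G.V := G.finV

instance : Fintype G.E := G.finE

/-- The set of edges carries the discrete topology. -/
instance : TopologicalSpace G.E := ⊥

/-- The space `Σ_G` of bi-infinite edge paths, with the topology inherited from the product. -/
abbrev ShiftSpace : Type := {e : ℤ → G.E // ∀ k, G.t (e k) = G.i (e (k + 1))}

/-- The shift map on `Σ_G`, `(σ e)ₖ = eₖ₊₁`. -/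
def shift : G.ShiftSpace ≃ₜ G.ShiftSpace where
  toFun e := ⟨fun k => e.1 (k + 1), fun k => e.2 (k + 1)⟩
  invFun e := ⟨fun k => e.1 (k - 1), fun k => by
    have h := e.2 (k - 1)
    rw [sub_add_cancel] at h
    simpa using h⟩
  left_inv e := by ext k; simp
  right_inv e := by ext k; simp
  continuous_toFun := by
    refine Continuous.subtype_mk (continuous_pi fun k => ?_) _
    exact (continuous_apply (k + 1)).comp continuous_subtype_val
  continuous_invFun := by
    refine Continuous.subtype_mk (continuous_pi fun k => ?_) _
    exact (continuous_apply (k - 1)).comp continuous_subtype_val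

end FinGraph

/-- `(X, φ)` is a shift of finite type: it is conjugate to `(Σ_G, σ)` for some `G`. -/
def SmaleSpace.IsShiftOfFiniteType (X : SmaleSpace.{u}) : Prop :=
  ∃ G : FinGraph, Conjugate X.φ G.shift

/-- A finite square matrix with entries in the nonnegative integers. -/
structure NatSquareMatrix where
  index : Type
  [fin : Fintype index]
  mat : Matrix index index ℕ

instance (A : NatSquareMatrix) : Fintype A.index := A.fin

/-- Elementary equivalence: `A = R S` and `B = S R` for rectangular nonnegative integer
matrices `R` and `S`. -/
def ElementaryEquivalent (A B : NatSquareMatrix) : Prop :=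
  ∃ (R : Matrix A.index B.index ℕ) (S : Matrix B.index A.index ℕ),
    A.mat = R * S ∧ B.mat = S * R

/-- Strong shift equivalence: a finite chain of (at least one) elementary equivalences. -/
def StrongShiftEquivalent : NatSquareMatrix → NatSquareMatrix → Prop :=
  Relation.TransGen ElementaryEquivalent

/-- The adjacency matrix of `G`: the `(v, w)` entry is the number of edges from `v` to `w`. -/
noncomputable def FinGraph.adjMatrix (G : FinGraph) : NatSquareMatrix where
  index := G.V
  mat := Matrix.of fun v w => Nat.card {e : G.E // G.i e = v ∧ G.t e = w}

/-!
A strong equivalence is the same as a conjugacy, so the theorem becomes Williams' theorem on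
conjugate shifts of finite type.

Suppose `S ← M → X` and `X ← M' → S` are correspondences whose compositions are identities. Both
composites live on fibre products of `M` and `M'`, one over `X` and one over `S`, and the
isomorphisms with the identities show that the two are the same subset of `M × M'`, mapping
bijectively to `S` and to `X`. This forces the legs of `M` to be injective as well as surjective,
hence homeomorphisms (`StronglyEquivalent.conjugate`). Conversely a conjugacy is itself s-bijective
and u-bijective, as uniform continuity makes it preserve asymptotic pairs.

If `A = R * S` and `B = S * R`, then bi-infinite paths in the graphs of `A` and `B` are two ways of
grouping the edges of an alternating path of `R`-edges and `S`-edges; this gives a conjugacy of the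
edge shifts, also for graphs with sources and sinks (`ElementaryEquivalent.conjugate`).

For the converse, consider finite clopen partitions of a compact system, given as maps `p` to a
finite set of labels, and the 0-1 matrix of transitions between their fibres. If `p` has the Markov
property that pasts and futures meeting in one fibre can be spliced, then each partition between `p`
and `p ∨ σ⁻¹p`, or between `p` and `p ∨ σp`, has a transition matrix elementary equivalent to that
of `p`. If `q` is coarser than `p`, then `p ∨ q^[-a,b]` is reached from `p` in such steps, where
`q^[-a,b]` is the partition by `q`-itineraries over the times from `-a` to `b`. For generating
Markov partitions `p` and `q`, compactness makes `q` coarser than some `P = p^[-n,n]`, and `P`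
coarser than some `q^[-m,m]`. So `p` leads to `P` and then to `P ∨ q^[-m,m]`, which is
`q^[-m,m]` up to labels, and `q` leads there as well
(`strongShiftEquivalent_transitionMatrix`). A conjugacy of edge shifts provides two such partitions
of the same space, by the edges at time `0`, and their transition matrices are elementary equivalent
to the adjacency matrices (`FinGraph.elementaryEquivalent_adjMatrix`).
-/

/-! ### Conjugacy and strong equivalence -/

theorem Conjugate.symm {X Y : Type*} [TopologicalSpace X] [TopologicalSpace Y]
    {φ : X ≃ₜ X} {ψ : Y ≃ₜ Y} (h : Conjugate φ ψ) : Conjugate ψ φ := by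
  obtain ⟨Θ, hΘ⟩ := h
  exact ⟨Θ.symm, fun y => Θ.injective (by rw [hΘ]; simp)⟩

theorem Conjugate.trans {X Y Z : Type*} [TopologicalSpace X] [TopologicalSpace Y]
    [TopologicalSpace Z] {φ : X ≃ₜ X} {ψ : Y ≃ₜ Y} {χ : Z ≃ₜ Z}
    (h : Conjugate φ ψ) (h' : Conjugate ψ χ) : Conjugate φ χ := by
  obtain ⟨Θ, hΘ⟩ := h
  obtain ⟨Θ', hΘ'⟩ := h'
  exact ⟨Θ.trans Θ', fun x => by simp [hΘ, hΘ']⟩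

theorem Continuous.tendsto_dist_zero {X Y : Type*} [MetricSpace X] [CompactSpace X]
    [MetricSpace Y] {f : X → Y} (hf : Continuous f) {a b : ℕ → X}
    (h : Tendsto (fun n => dist (a n) (b n)) atTop (𝓝 0)) :
    Tendsto (fun n => dist (f (a n)) (f (b n))) atTop (𝓝 0) := by
  have hu : UniformContinuous f := CompactSpace.uniformContinuous_of_continuous hf
  have h' := tendsto_uniformity_iff_dist_tendsto_zero (f := fun n => (a n, b n)).2 h
  exact tendsto_uniformity_iff_dist_tendsto_zero
    (f := fun n => (f (a n), f (b n))).1 (Tendsto.comp hu h')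

theorem Homeomorph.tendsto_dist_zero_iff {X Y : Type*} [MetricSpace X] [CompactSpace X]
    [MetricSpace Y] [CompactSpace Y] (Θ : X ≃ₜ Y) (a b : ℕ → X) :
    Tendsto (fun n => dist (Θ (a n)) (Θ (b n))) atTop (𝓝 0) ↔
      Tendsto (fun n => dist (a n) (b n)) atTop (𝓝 0) := by
  refine ⟨fun h => ?_, Θ.continuous.tendsto_dist_zero⟩
  simpa using Θ.symm.continuous.tendsto_dist_zero h

/-- A conjugacy of Smale spaces is s-bijective and u-bijective. -/
theorem isSBijective_and_isUBijective_of_conjugacy {X Y : SmaleSpace.{u}} (Θ : X ≃ₜ Y)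
    (hΘ : ∀ x, Θ (X.φ x) = Y.φ (Θ x)) :
    IsSBijective (X := X) (Y := Y) Θ ∧ IsUBijective (X := X) (Y := Y) Θ := by
  have hΘ' : ∀ x, Θ (X.φ.symm x) = Y.φ.symm (Θ x) := fun x =>
    Y.φ.injective (by rw [← hΘ]; simp)
  have hn : ∀ n x, Θ (X.φ^[n] x) = Y.φ^[n] (Θ x) := fun n =>
    (Function.Semiconj.iterate_right (f := Θ) (ga := X.φ) (gb := Y.φ) hΘ n)
  have hn' : ∀ n x, Θ (X.φ.symm^[n] x) = Y.φ.symm^[n] (Θ x) := fun n =>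
    (Function.Semiconj.iterate_right (f := Θ) (ga := X.φ.symm) (gb := Y.φ.symm) hΘ' n)
  have hs : ∀ x y, Θ y ∈ Y.stableSet (Θ x) ↔ y ∈ X.stableSet x := fun x y => by
    simp only [SmaleSpace.stableSet, mem_ofPred_eq, ← hn]
    exact Θ.tendsto_dist_zero_iff _ _
  have hu : ∀ x y, Θ y ∈ Y.unstableSet (Θ x) ↔ y ∈ X.unstableSet x := fun x y => by
    simp only [SmaleSpace.unstableSet, mem_ofPred_eq, ← hn']
    exact Θ.tendsto_dist_zero_iff _ _
  refine ⟨⟨⟨Θ.continuous, hΘ⟩, fun x => ⟨fun y hy => (hs x y).2 hy, Θ.injective.injOn, ?_⟩⟩,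
    ⟨⟨Θ.continuous, hΘ⟩, fun x => ⟨fun y hy => (hu x y).2 hy, Θ.injective.injOn, ?_⟩⟩⟩
  · intro y hy
    obtain ⟨y, rfl⟩ := Θ.surjective y
    exact ⟨y, (hs x y).1 hy, rfl⟩
  · intro y hy
    obtain ⟨y, rfl⟩ := Θ.surjective y
    exact ⟨y, (hu x y).1 hy, rfl⟩

theorem StronglyEquivalent.of_conjugate {S X : SmaleSpace.{u}} (h : Conjugate S.φ X.φ) :
    StronglyEquivalent S X := by
  obtain ⟨Θ, hΘ⟩ := h
  obtain ⟨hs, hu⟩ := isSBijective_and_isUBijective_of_conjugacy Θ hΘ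
  let C : Correspondence S X :=
    ⟨S, id, Θ, (Correspondence.refl S).u_bij, hs⟩
  let C' : Correspondence X S :=
    ⟨S, Θ, id, hu, (Correspondence.refl S).s_bij⟩
  -- Both fibre products are the diagonal of `S × S`.
  let e : (C.comp C').carrier ≃ₜ S :=
    { toFun := fun p => p.1.1
      invFun := fun x => ⟨(x, x), rfl⟩
      left_inv := fun p => Subtype.ext (Prod.ext rfl (Θ.injective p.2))
      right_inv := fun _ => rfl
      continuous_toFun := continuous_fst.comp continuous_subtype_val
      continuous_invFun := (continuous_id.prodMk continuous_id).subtype_mk _ }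
  let e' : (C'.comp C).carrier ≃ₜ S :=
    { toFun := fun p => p.1.1
      invFun := fun x => ⟨(x, x), rfl⟩
      left_inv := fun p => Subtype.ext (Prod.ext rfl p.2)
      right_inv := fun _ => rfl
      continuous_toFun := continuous_fst.comp continuous_subtype_val
      continuous_invFun := (continuous_id.prodMk continuous_id).subtype_mk _ }
  refine ⟨C, C', ⟨e, fun _ => rfl, fun _ => rfl, fun p => Θ.injective p.2⟩,
    ⟨e'.trans Θ, fun p => hΘ p.1.1, fun _ => rfl, fun p => ?_⟩⟩
  exact congrArg Θ (p.2 : p.1.1 = p.1.2)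

/-- If the compositions of `C` and `C'` are both identities, then `πs m = πu' m'` and
`πs' m' = πu m` define the same subset of `M × M'`, and this subset maps injectively to either
space. Hence both legs of `C` are bijections, and so homeomorphisms by compactness. -/
theorem StronglyEquivalent.conjugate {S X : SmaleSpace.{u}} (h : StronglyEquivalent S X) :
    Conjugate S.φ X.φ := by
  obtain ⟨C, C', ⟨Θ, -, hl, hr⟩, ⟨Θ', -, hl', hr'⟩⟩ := h
  replace hl : ∀ p, Θ p = C.πu p.1.1 := hl
  replace hr : ∀ p, Θ p = C'.πs p.1.2 := hr
  replace hl' : ∀ p, Θ' p = C'.πu p.1.1 := hl'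
  replace hr' : ∀ p, Θ' p = C.πs p.1.2 := hr'
  have h1 : ∀ m m', C.πs m = C'.πu m' → C'.πs m' = C.πu m := fun m m' h =>
    (hr ⟨(m, m'), h⟩).symm.trans (hl ⟨(m, m'), h⟩)
  have h2 : ∀ m m', C'.πs m' = C.πu m → C.πs m = C'.πu m' := fun m m' h =>
    (hr' ⟨(m', m), h⟩).symm.trans (hl' ⟨(m', m), h⟩)
  have surj_u : Function.Surjective C.πu := fun x => by
    obtain ⟨p, rfl⟩ := Θ.surjective x
    exact ⟨_, (hl p).symm⟩
  have surj_s : Function.Surjective C.πs := fun y => by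
    obtain ⟨p, rfl⟩ := Θ'.surjective y
    exact ⟨_, (hr' p).symm⟩
  have surj_u' : Function.Surjective C'.πu := fun y => by
    obtain ⟨p, rfl⟩ := Θ'.surjective y
    exact ⟨_, (hl' p).symm⟩
  have inj_u : Function.Injective C.πu := fun m₁ m₂ hm => by
    obtain ⟨m', hm'⟩ := surj_u' (C.πs m₁)
    have e1 : C.πs m₁ = C'.πu m' := hm'.symm
    have e2 : C.πs m₂ = C'.πu m' := h2 _ _ ((h1 _ _ e1).trans hm)
    let z₁ : (C.comp C').carrier := ⟨(m₁, m'), e1⟩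
    let z₂ : (C.comp C').carrier := ⟨(m₂, m'), e2⟩
    have hz : z₁ = z₂ := Θ.injective ((hl z₁).trans (hm.trans (hl z₂).symm))
    exact congrArg (fun z => z.1.1) hz
  have inj_s : Function.Injective C.πs := fun m₁ m₂ hm => by
    obtain ⟨m', hm'⟩ := surj_u' (C.πs m₁)
    have e1 : C.πs m₁ = C'.πu m' := hm'.symm
    have e2 : C.πs m₂ = C'.πu m' := hm.symm.trans e1
    let z₁ : (C'.comp C).carrier := ⟨(m', m₁), h1 _ _ e1⟩
    let z₂ : (C'.comp C).carrier := ⟨(m', m₂), h1 _ _ e2⟩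
    have hz : z₁ = z₂ := Θ'.injective ((hr' z₁).trans (hm.trans (hr' z₂).symm))
    exact congrArg (fun z => z.1.2) hz
  have c1 : Conjugate C.M.φ S.φ :=
    ⟨C.u_bij.1.1.homeoOfEquivCompactToT2 (f := Equiv.ofBijective _ ⟨inj_u, surj_u⟩), C.u_bij.1.2⟩
  have c2 : Conjugate C.M.φ X.φ :=
    ⟨C.s_bij.1.1.homeoOfEquivCompactToT2 (f := Equiv.ofBijective _ ⟨inj_s, surj_s⟩), C.s_bij.1.2⟩
  exact c1.symm.trans c2

theorem stronglyEquivalent_iff_conjugate {S X : SmaleSpace.{u}} :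
    StronglyEquivalent S X ↔ Conjugate S.φ X.φ :=
  ⟨StronglyEquivalent.conjugate, StronglyEquivalent.of_conjugate⟩

/-! ### Strong shift equivalence of transition matrices of partitions -/

theorem StrongShiftEquivalent.symm {A B : NatSquareMatrix} (h : StrongShiftEquivalent A B) :
    StrongShiftEquivalent B A :=
  have : Std.Symm ElementaryEquivalent := ⟨fun _ _ ⟨R, S, hA, hB⟩ => ⟨S, R, hB, hA⟩⟩
  Relation.TransGen.stdSymm.symm _ _ h

theorem StrongShiftEquivalent.trans {A B C : NatSquareMatrix} (h : StrongShiftEquivalent A B)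
    (h' : StrongShiftEquivalent B C) : StrongShiftEquivalent A C :=
  Relation.TransGen.trans h h'

theorem ElementaryEquivalent.strongShiftEquivalent {A B : NatSquareMatrix}
    (h : ElementaryEquivalent A B) : StrongShiftEquivalent A B :=
  Relation.TransGen.single h

section Partition

open Classical in
/-- The transition matrix of the partition of `X` into the fibres of `p`: the `(a, b)` entry is `1`
if some point of the fibre of `a` is mapped by `σ` into the fibre of `b`, and `0` otherwise.
Labels with an empty fibre are kept, as zero rows and columns. -/
noncomputable def transitionMatrix {X : Type*} {α : Type} [Fintype α] (σ : X → X) (p : X → α) :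
    NatSquareMatrix where
  index := α
  mat := Matrix.of fun a b => if ∃ x, p x = a ∧ p (σ x) = b then 1 else 0

open Classical in
/-- A sum of products of indicators with at most one nonzero term is an indicator. -/
theorem sum_indicator_mul_indicator {ι : Type*} [Fintype ι] (P Q : ι → Prop) (T : Prop)
    (hT : (∃ c, P c ∧ Q c) ↔ T) (huniq : ∀ c d, P c → Q c → P d → Q d → c = d) :
    ∑ c, (if P c then 1 else 0) * (if Q c then 1 else 0) = if T then 1 else 0 := by
  by_cases h : T
  · obtain ⟨c, hP, hQ⟩ := hT.2 h
    rw [Finset.sum_eq_single c]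
    · simp [hP, hQ, h]
    · intro d _ hd
      by_cases hPd : P d
      · by_cases hQd : Q d
        · exact absurd (huniq d c hPd hQd hP hQ) hd
        · simp [hQd]
      · simp [hPd]
    · simp
  · rw [if_neg h]
    refine Finset.sum_eq_zero fun c _ => ?_
    by_cases hP : P c
    · have hQ : ¬ Q c := fun hQ => h (hT.1 ⟨c, hP, hQ⟩)
      simp [hQ]
    · simp [hP]

variable {X : Type*} [TopologicalSpace X]

/-- The Markov property of the partition of `X` into the fibres of `p`: whenever two points lie in
the same fibre, the past itinerary of the one can be spliced with the future itinerary of the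
other. -/
def Splices {α : Type*} (σ : X ≃ₜ X) (p : X → α) : Prop :=
  ∀ x y, p x = p y → ∃ z, (∀ k : ℤ, k ≤ 0 → p ((σ ^ k) z) = p ((σ ^ k) x)) ∧
    ∀ k : ℤ, 0 ≤ k → p ((σ ^ k) z) = p ((σ ^ k) y)

/-- The partition of `X` by itineraries over the times from `-a` to `b`. -/
def window {β : Type*} (σ : X ≃ₜ X) (q : X → β) (a b : ℕ) (x : X) :
    Finset.Icc (-a : ℤ) b → β :=
  fun k => q ((σ ^ (k : ℤ)) x)

theorem window_eq_iff {β : Type*} {σ : X ≃ₜ X} {q : X → β} {a b : ℕ} {x y : X} :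
    window σ q a b x = window σ q a b y ↔
      ∀ k : ℤ, -a ≤ k → k ≤ b → q ((σ ^ k) x) = q ((σ ^ k) y) := by
  simp [window, funext_iff]

variable {α β : Type} {σ : X ≃ₜ X} {p : X → α} {q : X → β}

/-- A Markov partition `p` and a partition `q` with `p ≤ q ≤ p ∨ σ⁻¹p` have elementary equivalent
transition matrices: `R` records which fibres meet, and `S` the transitions from `q` to `p`. -/
theorem Splices.elementaryEquivalent_forward [Fintype α] [Fintype β]
    (hp : Splices σ p)
    (hpq : ∀ x y, q x = q y → p x = p y)
    (hq : ∀ x y, p x = p y → p (σ x) = p (σ y) → q x = q y) :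
    ElementaryEquivalent (transitionMatrix σ p) (transitionMatrix σ q) := by
  classical
  refine ⟨Matrix.of fun a c => if ∃ x, p x = a ∧ q x = c then 1 else 0,
    Matrix.of fun c b => if ∃ x, q x = c ∧ p (σ x) = b then 1 else 0, ?_, ?_⟩
  · ext a b
    rw [Matrix.mul_apply]
    simp only [transitionMatrix]
    refine (sum_indicator_mul_indicator _ _ _ ⟨?_, ?_⟩ ?_).symm
    · rintro ⟨c, ⟨x, hx, hxc⟩, y, hy, hyb⟩
      exact ⟨y, (hpq _ _ (hy.trans hxc.symm)).trans hx, hyb⟩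
    · rintro ⟨x, hx, hxb⟩
      exact ⟨q x, ⟨x, hx, rfl⟩, x, rfl, hxb⟩
    · rintro c d ⟨x, hx, rfl⟩ ⟨y, hy, hyb⟩ ⟨x', hx', rfl⟩ ⟨y', hy', hyb'⟩
      rw [← hy, ← hy']
      refine hq _ _ ?_ (hyb.trans hyb'.symm)
      rw [hpq _ _ hy, hpq _ _ hy', hx, hx']
  · ext c d
    rw [Matrix.mul_apply]
    simp only [transitionMatrix]
    refine (sum_indicator_mul_indicator _ _ _ ⟨?_, ?_⟩ ?_).symm
    · rintro ⟨a, ⟨x, hx, hxa⟩, y, hy, hyd⟩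
      obtain ⟨z, hz, hz'⟩ := hp (σ x) y (hxa.trans hy.symm)
      have z0 : p (σ (σ.symm z)) = p (σ x) := by simpa using hz 0 le_rfl
      have z1 : p (σ.symm z) = p x := by simpa using hz (-1) (by norm_num)
      refine ⟨σ.symm z, (hq _ _ z1 z0).trans hx, ?_⟩
      rw [σ.apply_symm_apply, ← hyd]
      exact hq _ _ (by simpa using hz' 0 le_rfl) (by simpa using hz' 1 (by norm_num))
    · rintro ⟨x, hx, hxd⟩
      exact ⟨p (σ x), ⟨x, hx, rfl⟩, σ x, rfl, hxd⟩
    · rintro a b ⟨x, hx, hxa⟩ ⟨y, hy, hyd⟩ ⟨x', hx', hxb⟩ ⟨y', hy', hyd'⟩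
      rw [← hy, ← hy']
      exact hpq _ _ (hyd.trans hyd'.symm)

/-- The mirror image of `Splices.elementaryEquivalent_forward`, for `p ≤ q ≤ p ∨ σp`. -/
theorem Splices.elementaryEquivalent_backward [Fintype α] [Fintype β]
    (hp : Splices σ p)
    (hpq : ∀ x y, q x = q y → p x = p y)
    (hq : ∀ x y, p x = p y → p (σ x) = p (σ y) → q (σ x) = q (σ y)) :
    ElementaryEquivalent (transitionMatrix σ p) (transitionMatrix σ q) := by
  classical
  refine ⟨Matrix.of fun a c => if ∃ x, p x = a ∧ q (σ x) = c then 1 else 0,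
    Matrix.of fun c b => if ∃ x, q x = c ∧ p x = b then 1 else 0, ?_, ?_⟩
  · ext a b
    rw [Matrix.mul_apply]
    simp only [transitionMatrix]
    refine (sum_indicator_mul_indicator _ _ _ ⟨?_, ?_⟩ ?_).symm
    · rintro ⟨c, ⟨x, hx, hxc⟩, y, hy, hyb⟩
      exact ⟨x, hx, (hpq _ _ (hxc.trans hy.symm)).trans hyb⟩
    · rintro ⟨x, hx, hxb⟩
      exact ⟨q (σ x), ⟨x, hx, rfl⟩, σ x, rfl, hxb⟩
    · rintro c d ⟨x, hx, rfl⟩ ⟨y, hy, hyb⟩ ⟨x', hx', rfl⟩ ⟨y', hy', hyb'⟩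
      refine hq _ _ (hx.trans hx'.symm) ?_
      rw [← hpq _ _ hy, ← hpq _ _ hy', hyb, hyb']
  · ext c d
    rw [Matrix.mul_apply]
    simp only [transitionMatrix]
    refine (sum_indicator_mul_indicator _ _ _ ⟨?_, ?_⟩ ?_).symm
    · rintro ⟨a, ⟨x, hx, hxa⟩, y, hy, hyd⟩
      obtain ⟨z, hz, hz'⟩ := hp x y (hxa.trans hy.symm)
      have z0 : p z = p y := by simpa using hz' 0 le_rfl
      have z1 : p (σ z) = p (σ y) := by simpa using hz' 1 (by norm_num)
      refine ⟨z, ?_, (hq _ _ z0 z1).trans hyd⟩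
      have w0 : p z = p x := by simpa using hz 0 le_rfl
      have w1 : p (σ.symm z) = p (σ.symm x) := by simpa using hz (-1) (by norm_num)
      have := hq (σ.symm z) (σ.symm x) w1 (by simpa using w0)
      simpa [hx] using this
    · rintro ⟨x, hx, hxd⟩
      exact ⟨p x, ⟨x, hx, rfl⟩, x, rfl, hxd⟩
    · rintro a b ⟨x, hx, hxa⟩ ⟨y, hy, hyd⟩ ⟨x', hx', hxb⟩ ⟨y', hy', hyd'⟩
      rw [← hxa, ← hxb]
      exact hpq _ _ (hx.trans hx'.symm)

/-- Over a window containing time `0`, the itineraries of a partition coarser than `p` inherit the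
splicing of `p`. -/
theorem Splices.prod_window (hp : Splices σ p) (hqp : ∀ x y, p x = p y → q x = q y) (a b : ℕ) :
    Splices σ fun x => (p x, window σ q a b x) := by
  intro x y hxy
  obtain ⟨h0, hw⟩ := Prod.ext_iff.1 hxy
  rw [window_eq_iff] at hw
  obtain ⟨z, hz, hz'⟩ := hp x y h0
  refine ⟨z, fun k hk => Prod.ext (hz k hk) (window_eq_iff.2 fun j hj hj' => ?_),
    fun k hk => Prod.ext (hz' k hk) (window_eq_iff.2 fun j hj hj' => ?_)⟩
  · rw [← Homeomorph.mul_apply, ← Homeomorph.mul_apply, ← zpow_add]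
    rcases le_total (j + k) 0 with h | h
    · exact hqp _ _ (hz _ h)
    · rw [hqp _ _ (hz' _ h), hw _ (by omega) (by omega)]
  · rw [← Homeomorph.mul_apply, ← Homeomorph.mul_apply, ← zpow_add]
    rcases le_total (j + k) 0 with h | h
    · rw [hqp _ _ (hz _ h), hw _ (by omega) (by omega)]
    · exact hqp _ _ (hz' _ h)

/-- Enlarging a window one step at a time, forwards or backwards, gives a chain of elementary
equivalences. -/
theorem Splices.strongShiftEquivalent_prod_window [Fintype α] [Fintype β]
    (hp : Splices σ p)
    (hqp : ∀ x y, p x = p y → q x = q y) (a b : ℕ) :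
    StrongShiftEquivalent (transitionMatrix σ p)
      (transitionMatrix σ fun x => (p x, window σ q a b x)) := by
  have shift : ∀ (k : ℤ) x, (σ ^ k) (σ x) = (σ ^ (k + 1)) x := fun k x => by
    rw [zpow_add_one]; rfl
  induction a with
  | zero =>
    induction b with
    | zero =>
      refine (hp.elementaryEquivalent_forward (fun x y h => congrArg Prod.fst h)
        fun x y h _ => Prod.ext h (window_eq_iff.2 fun k hk hk' => ?_)).strongShiftEquivalent
      obtain rfl : k = 0 := by omega
      simpa using hqp _ _ h
    | succ b ih =>
      refine ih.trans ((hp.prod_window hqp 0 b).elementaryEquivalent_forward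
        (fun x y h => ?_) fun x y h h' => ?_).strongShiftEquivalent
      · obtain ⟨h0, hw⟩ := Prod.ext_iff.1 h
        rw [window_eq_iff] at hw
        exact Prod.ext h0 (window_eq_iff.2 fun k hk hk' => hw k (by omega) (by omega))
      · obtain ⟨h0, hw⟩ := Prod.ext_iff.1 h
        have hw' := (Prod.ext_iff.1 h').2
        rw [window_eq_iff] at hw hw'
        refine Prod.ext h0 (window_eq_iff.2 fun k hk hk' => ?_)
        rcases le_or_gt k b with hkb | hkb
        · exact hw k hk hkb
        · have := hw' (k - 1) (by omega) (by omega)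
          simpa only [shift, sub_add_cancel] using this
  | succ a ih =>
    refine ih.trans ((hp.prod_window hqp a b).elementaryEquivalent_backward
      (fun x y h => ?_) fun x y h h' => ?_).strongShiftEquivalent
    · obtain ⟨h0, hw⟩ := Prod.ext_iff.1 h
      rw [window_eq_iff] at hw
      exact Prod.ext h0 (window_eq_iff.2 fun k hk hk' => hw k (by omega) (by omega))
    · obtain ⟨h0, hw'⟩ := Prod.ext_iff.1 h'
      have hw := (Prod.ext_iff.1 h).2
      rw [window_eq_iff] at hw hw'
      refine Prod.ext h0 (window_eq_iff.2 fun k hk hk' => ?_)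
      rcases le_or_gt (-a : ℤ) k with hka | hka
      · exact hw' k hka hk'
      · simpa only [shift] using hw (k + 1) (by omega) (by omega)

/-- The partition into the fibres of `p` is generating: itineraries separate points. -/
def Generates {α : Type*} (σ : X ≃ₜ X) (p : X → α) : Prop :=
  ∀ x y, (∀ k : ℤ, p ((σ ^ k) x) = p ((σ ^ k) y)) → x = y

/-- On a compact space, a finite clopen partition is coarser than the itineraries of a generating
one over a long enough window. -/
theorem Generates.exists_window [CompactSpace X] [T2Space X] [TopologicalSpace α]
    [DiscreteTopology α] [TopologicalSpace β] [DiscreteTopology β] (hg : Generates σ p)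
    (hp : Continuous p) (hq : Continuous q) :
    ∃ n : ℕ, ∀ x y, window σ p n n x = window σ p n n y → q x = q y := by
  by_contra! hcon
  -- The pairs violating the conclusion for `n` form a decreasing sequence of compact sets.
  let K : ℕ → Set (X × X) := fun n =>
    {z | window σ p n n z.1 = window σ p n n z.2 ∧ q z.1 ≠ q z.2}
  have hcont : ∀ n, Continuous (window σ p n n) := fun n =>
    continuous_pi fun k => hp.comp (σ ^ (k : ℤ)).continuous
  have hK : ∀ n, IsClosed (K n) := fun n => by
    refine (isClosed_eq ((hcont n).comp continuous_fst) ((hcont n).comp continuous_snd)).inter ?_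
    exact (isClosed_discrete {w : β × β | w.1 ≠ w.2}).preimage
      ((hq.comp continuous_fst).prodMk (hq.comp continuous_snd))
  obtain ⟨z, hz⟩ := IsCompact.nonempty_iInter_of_sequence_nonempty_isCompact_isClosed K
    (fun n z hz => ⟨window_eq_iff.2 fun k hk hk' =>
      window_eq_iff.1 hz.1 k (by push_cast; omega) (by push_cast; omega), hz.2⟩)
    (fun n => by
      obtain ⟨x, y, h, h'⟩ := hcon n
      exact ⟨(x, y), h, h'⟩) (hK 0).isCompact hK
  rw [mem_iInter] at hz
  refine (hz 0).2 (congrArg q (hg _ _ fun k => ?_))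
  exact window_eq_iff.1 (hz k.natAbs).1 k (by omega) (by omega)

/-- Any two generating clopen Markov partitions of the same compact system have strong shift
equivalent transition matrices. -/
theorem strongShiftEquivalent_transitionMatrix [Fintype α] [Fintype β]
    [CompactSpace X] [T2Space X] [TopologicalSpace α] [DiscreteTopology α]
    [TopologicalSpace β] [DiscreteTopology β]
    (hp : Splices σ p) (hgp : Generates σ p) (hcp : Continuous p)
    (hq : Splices σ q) (hgq : Generates σ q) (hcq : Continuous q) :
    StrongShiftEquivalent (transitionMatrix σ p) (transitionMatrix σ q) := by
  obtain ⟨n, hn⟩ := hgp.exists_window hcp hcq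
  let P := fun x => (p x, window σ p n n x)
  have hP : Splices σ P := hp.prod_window (fun _ _ h => h) n n
  have hcP : Continuous P :=
    hcp.prodMk (continuous_pi fun k => hcp.comp (σ ^ (k : ℤ)).continuous)
  have hqP : ∀ x y, P x = P y → q x = q y := fun x y h => hn x y (Prod.ext_iff.1 h).2
  obtain ⟨m, hm⟩ := hgq.exists_window hcq hcP
  -- `P ∨ q^[-m,m]` and `q ∨ q^[-m,m]` are the same partition with different labels.
  have hlabel : ElementaryEquivalent (transitionMatrix σ fun x => (q x, window σ q m m x))
      (transitionMatrix σ fun x => (P x, window σ q m m x)) :=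
    (hq.prod_window (fun _ _ h => h) m m).elementaryEquivalent_forward
      (fun x y h => Prod.ext (hqP x y (Prod.ext_iff.1 h).1) (Prod.ext_iff.1 h).2)
      fun x y h _ => Prod.ext (hm x y (Prod.ext_iff.1 h).2) (Prod.ext_iff.1 h).2
  exact ((hp.strongShiftEquivalent_prod_window (fun _ _ h => h) n n).trans
    (hP.strongShiftEquivalent_prod_window hqP m m)).trans
    ((hq.strongShiftEquivalent_prod_window (fun _ _ h => h) m m).trans
      hlabel.strongShiftEquivalent).symm

end Partition

/-! ### Path spaces of finite graphs and elementary equivalence -/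

section PathSpace

/-- The bi-infinite paths in the directed graph with edge set `E`, initial vertices `i` and
terminal vertices `t`. Sources and sinks are allowed: they occur in the graphs of the intermediate
matrices of a strong shift equivalence. -/
abbrev PathSpace {V E : Type*} (i t : E → V) : Type _ :=
  {e : ℤ → E // ∀ k, t (e k) = i (e (k + 1))}

theorem PathSpace.continuous_apply {V E : Type*} [TopologicalSpace E] {i t : E → V} (k : ℤ) :
    Continuous fun x : PathSpace i t => x.1 k :=
  (_root_.continuous_apply k).comp continuous_subtype_val

/-- The shift map on bi-infinite paths. -/
def pathShift {V E : Type*} [TopologicalSpace E] (i t : E → V) :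
    PathSpace i t ≃ₜ PathSpace i t where
  toFun e := ⟨fun k => e.1 (k + 1), fun k => e.2 (k + 1)⟩
  invFun e := ⟨fun k => e.1 (k - 1), fun k => by
    have h := e.2 (k - 1)
    rw [sub_add_cancel] at h
    simpa using h⟩
  left_inv e := by ext k; simp
  right_inv e := by ext k; simp
  continuous_toFun :=
    (continuous_pi fun k => PathSpace.continuous_apply (k + 1)).subtype_mk _
  continuous_invFun :=
    (continuous_pi fun k => PathSpace.continuous_apply (k - 1)).subtype_mk _

/-- A bijection of edges that preserves end points induces a conjugacy. -/
theorem conjugate_pathShift_of_equiv {V E E' : Type*} [TopologicalSpace E] [DiscreteTopology E]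
    [TopologicalSpace E'] [DiscreteTopology E'] {i t : E → V} {i' t' : E' → V} (f : E ≃ E')
    (hi : ∀ e, i' (f e) = i e) (ht : ∀ e, t' (f e) = t e) :
    Conjugate (pathShift i t) (pathShift i' t') := by
  refine ⟨{ toFun := fun x => ⟨fun k => f (x.1 k), fun k => by rw [hi, ht, x.2]⟩
            invFun := fun y => ⟨fun k => f.symm (y.1 k), fun k => by
              rw [← hi, ← ht, f.apply_symm_apply, f.apply_symm_apply, y.2]⟩
            left_inv := fun x => by ext k; simp
            right_inv := fun y => by ext k; simp
            continuous_toFun := ?_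
            continuous_invFun := ?_ }, ?_⟩
  · exact (continuous_pi fun k => continuous_of_discreteTopology.comp
      (PathSpace.continuous_apply k)).subtype_mk _
  · exact (continuous_pi fun k => continuous_of_discreteTopology.comp
      (PathSpace.continuous_apply k)).subtype_mk _
  · exact fun _ => Subtype.ext (funext fun _ => rfl)

/-- The edges that are composed of an `R`-edge followed by an `S`-edge. -/
abbrev ComposedEdge {W E F : Type*} (tR : E → W) (iS : F → W) : Type _ :=
  {p : E × F // tR p.1 = iS p.2}

/-- Let `R`-edges lead from `V` to `W` and `S`-edges from `W` to `V`. A bi-infinite path in the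
bipartite graph alternates between the two, and grouping its edges into pairs `RS` or into pairs
`SR` gives conjugate shifts. -/
theorem conjugate_pathShift_composedEdge {V W E F : Type*} [TopologicalSpace E]
    [DiscreteTopology E] [TopologicalSpace F] [DiscreteTopology F]
    (iR : E → V) (tR : E → W) (iS : F → W) (tS : F → V) :
    Conjugate
      (pathShift (fun p : ComposedEdge tR iS => iR p.1.1) fun p => tS p.1.2)
      (pathShift (fun p : ComposedEdge tS iR => iS p.1.1) fun p => tR p.1.2) := by
  refine ⟨{ toFun := fun x => ⟨fun k => ⟨((x.1 k).1.2, (x.1 (k + 1)).1.1), x.2 k⟩,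
              fun k => (x.1 (k + 1)).2⟩
            invFun := fun y => ⟨fun k => ⟨((y.1 (k - 1)).1.2, (y.1 k).1.1), ?_⟩,
              fun k => ?_⟩
            left_inv := fun x => ?_
            right_inv := fun y => ?_
            continuous_toFun := ?_
            continuous_invFun := ?_ }, ?_⟩
  · simpa using y.2 (k - 1)
  · simpa using (y.1 k).2
  · ext k <;> simp
  · ext k <;> simp
  · refine (continuous_pi fun k => Continuous.subtype_mk ?_ _).subtype_mk _
    exact (continuous_snd.comp (continuous_subtype_val.comp (PathSpace.continuous_apply k))).prodMk
      (continuous_fst.comp (continuous_subtype_val.comp (PathSpace.continuous_apply (k + 1))))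
  · refine (continuous_pi fun k => Continuous.subtype_mk ?_ _).subtype_mk _
    exact (continuous_snd.comp
      (continuous_subtype_val.comp (PathSpace.continuous_apply (k - 1)))).prodMk
        (continuous_fst.comp (continuous_subtype_val.comp (PathSpace.continuous_apply k)))
  · exact fun _ => rfl

/-- The edges of the graph with adjacency matrix `A`; for a rectangular `A` they lead from `V` to
`W`. -/
abbrev NatSquareMatrix.Edge {V W : Type} (A : Matrix V W ℕ) : Type :=
  Σ p : V × W, Fin (A p.1 p.2)

/-- The shift on the bi-infinite paths in the graph with adjacency matrix `A`. -/
def NatSquareMatrix.edgeShift (A : NatSquareMatrix) :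
    PathSpace (fun e : NatSquareMatrix.Edge A.mat => e.1.1) (fun e => e.1.2) ≃ₜ
      PathSpace (fun e : NatSquareMatrix.Edge A.mat => e.1.1) fun e => e.1.2 :=
  pathShift _ _

/-- If `A = R * S`, an edge of the graph of `A` amounts to an edge of the graph of `R` followed by
one of the graph of `S`. -/
theorem exists_edge_equiv_composedEdge {V W : Type} [Fintype W] {A : Matrix V V ℕ}
    {R : Matrix V W ℕ} {S : Matrix W V ℕ} (h : A = R * S) :
    ∃ f : NatSquareMatrix.Edge A ≃ ComposedEdge
        (fun e : NatSquareMatrix.Edge R => e.1.2) (fun e : NatSquareMatrix.Edge S => e.1.1),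
      (∀ e, (f e).1.1.1.1 = e.1.1) ∧ ∀ e, (f e).1.2.1.2 = e.1.2 := by
  classical
  have hcard : ∀ p : V × V,
      Nonempty (Fin (A p.1 p.2) ≃ Σ k : W, Fin (R p.1 k) × Fin (S k p.2)) := fun p => by
    rw [← Fintype.card_eq, Fintype.card_fin, h]
    simp [Matrix.mul_apply]
  let f' : (Σ p : V × V, Σ k : W, Fin (R p.1 k) × Fin (S k p.2)) ≃ ComposedEdge
      (fun e : NatSquareMatrix.Edge R => e.1.2) (fun e : NatSquareMatrix.Edge S => e.1.1) :=
    { toFun := fun z => ⟨(⟨(z.1.1, z.2.1), z.2.2.1⟩, ⟨(z.2.1, z.1.2), z.2.2.2⟩), rfl⟩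
      invFun := fun z => ⟨(z.1.1.1.1, z.1.2.1.2), z.1.2.1.1,
        Fin.cast (congrArg (R _) z.2) z.1.1.2, z.1.2.2⟩
      left_inv := fun z => rfl
      right_inv := by
        rintro ⟨⟨⟨⟨v, k⟩, r⟩, ⟨⟨k', w⟩, s⟩⟩, hk⟩
        obtain rfl : k = k' := hk
        rfl }
  exact ⟨(Equiv.sigmaCongrRight fun p => (hcard p).some).trans f', fun _ => rfl, fun _ => rfl⟩

theorem ElementaryEquivalent.conjugate {A B : NatSquareMatrix} (h : ElementaryEquivalent A B) :
    Conjugate A.edgeShift B.edgeShift := by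
  obtain ⟨R, S, hA, hB⟩ := h
  obtain ⟨f, hf, hf'⟩ := exists_edge_equiv_composedEdge hA
  obtain ⟨g, hg, hg'⟩ := exists_edge_equiv_composedEdge hB
  exact ((conjugate_pathShift_of_equiv f hf hf').trans
    (conjugate_pathShift_composedEdge _ _ _ _)).trans
    (conjugate_pathShift_of_equiv g hg hg').symm

theorem StrongShiftEquivalent.conjugate {A B : NatSquareMatrix} (h : StrongShiftEquivalent A B) :
    Conjugate A.edgeShift B.edgeShift := by
  induction h with
  | single h => exact h.conjugate
  | tail _ h ih => exact ih.trans h.conjugate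

end PathSpace

/-! ### Edge shifts of graphs without sources and sinks -/

namespace FinGraph

variable (G : FinGraph)

instance : DiscreteTopology G.E := ⟨rfl⟩

theorem conjugate_shift_edgeShift : Conjugate G.shift G.adjMatrix.edgeShift := by
  have hcard : ∀ p : G.V × G.V,
      Nonempty ({e : G.E // (G.i e, G.t e) = p} ≃ Fin (G.adjMatrix.mat p.1 p.2)) := fun p => by
    refine ⟨Finite.equivFinOfCardEq ?_⟩
    simp [adjMatrix, Prod.ext_iff]
  exact conjugate_pathShift_of_equiv (i := G.i) (t := G.t)
    (i' := fun e : NatSquareMatrix.Edge G.adjMatrix.mat => e.1.1) (t' := fun e => e.1.2)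
    ((Equiv.sigmaFiberEquiv fun e => (G.i e, G.t e)).symm.trans (Equiv.sigmaCongrRight fun p => (hcard p).some))
    (fun _ => rfl) fun _ => rfl

theorem conjugate_shift_of_strongShiftEquivalent {G H : FinGraph}
    (h : StrongShiftEquivalent G.adjMatrix H.adjMatrix) : Conjugate G.shift H.shift :=
  (G.conjugate_shift_edgeShift.trans h.conjugate).trans H.conjugate_shift_edgeShift.symm

instance : CompactSpace G.ShiftSpace := by
  refine isCompact_iff_compactSpace.1 (IsClosed.isCompact ?_)
  have : {e : ℤ → G.E | ∀ k, G.t (e k) = G.i (e (k + 1))} =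
      ⋂ k, {e | G.t (e k) = G.i (e (k + 1))} := by ext; simp
  change IsClosed {e : ℤ → G.E | ∀ k, G.t (e k) = G.i (e (k + 1))}
  rw [this]
  refine isClosed_iInter fun k => ?_
  exact (isClosed_discrete {w : G.E × G.E | G.t w.1 = G.i w.2}).preimage
    (f := fun e : ℤ → G.E => (e k, e (k + 1)))
    ((continuous_apply k).prodMk (continuous_apply (k + 1)))

variable {G}

theorem shift_zpow_apply (k : ℤ) (x : G.ShiftSpace) (j : ℤ) :
    ((G.shift ^ k) x).1 j = x.1 (j + k) := by
  induction k using Int.induction_on generalizing j with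
  | zero => simp
  | succ k ih =>
    rw [add_comm, zpow_one_add]
    change ((G.shift ^ (k : ℤ)) x).1 (j + 1) = _
    rw [ih, add_assoc]
  | pred k ih =>
    rw [show -(k : ℤ) - 1 = -1 + -k by ring, zpow_add, zpow_neg_one]
    change ((G.shift ^ (-k : ℤ)) x).1 (j - 1) = _
    rw [ih]
    ring_nf

/-- Two edge paths through a common vertex at time `0` can be joined there. -/
def join (x y : G.ShiftSpace) (h : G.t (x.1 0) = G.i (y.1 1)) : G.ShiftSpace :=
  ⟨fun k => if k ≤ 0 then x.1 k else y.1 k, fun k => by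
    dsimp only
    rcases lt_trichotomy k 0 with hk | rfl | hk
    · rw [if_pos hk.le, if_pos (by omega), x.2]
    · simpa using h
    · rw [if_neg (by omega), if_neg (by omega), y.2]⟩

/-- As there are no sources and sinks, every edge lies on a bi-infinite path. -/
theorem exists_path (e : G.E) : ∃ x : G.ShiftSpace, x.1 0 = e := by
  choose s hs using G.no_source
  choose f hf using G.no_sink
  refine ⟨⟨fun k => if 0 ≤ k then (fun e => f (G.t e))^[k.toNat] e
    else (fun e => s (G.i e))^[(-k).toNat] e, fun k => ?_⟩, by simp⟩
  dsimp only
  rcases lt_or_ge k 0 with hk | hk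
  · obtain ⟨n, rfl⟩ : ∃ n : ℕ, k = -(n + 1) := ⟨(-k - 1).toNat, by omega⟩
    have h1 : (-(-((n : ℤ) + 1))).toNat = n + 1 := by omega
    rw [if_neg (by omega), h1, Function.iterate_succ_apply', hs]
    rcases Nat.eq_zero_or_pos n with rfl | hn
    · simp
    · rw [if_neg (by omega), show (-(-((n : ℤ) + 1) + 1)).toNat = n by omega]
  · obtain ⟨n, rfl⟩ := Int.eq_ofNat_of_zero_le hk
    rw [if_pos hk, if_pos (by omega), show ((n : ℤ) + 1).toNat = n + 1 by omega,
      Function.iterate_succ_apply', hf, Int.toNat_natCast]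

theorem splices_zero : Splices G.shift fun x => x.1 0 := by
  intro x y (hxy : x.1 0 = y.1 0)
  refine ⟨join x y (by rw [hxy]; simpa using y.2 0), fun k hk => ?_, fun k hk => ?_⟩
  · simp [shift_zpow_apply, join, hk]
  · rcases hk.eq_or_lt with rfl | hk
    · simpa [join] using hxy
    · simp [shift_zpow_apply, join, hk]

theorem generates_zero : Generates G.shift fun x => x.1 0 := fun x y h => by
  ext k
  simpa [shift_zpow_apply] using h k

theorem continuous_zero : Continuous fun x : G.ShiftSpace => x.1 0 :=
  PathSpace.continuous_apply 0

/-- The transition matrix between edges is elementary equivalent to the one that counts edges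
between vertices. -/
theorem elementaryEquivalent_adjMatrix :
    ElementaryEquivalent G.adjMatrix (transitionMatrix G.shift fun x => x.1 0) := by
  classical
  refine ⟨Matrix.of fun v e => if G.i e = v then 1 else 0,
    Matrix.of fun e w => if G.t e = w then 1 else 0, ?_, ?_⟩
  · ext v w
    rw [Matrix.mul_apply]
    change Nat.card {e : G.E // G.i e = v ∧ G.t e = w} =
      ∑ e : G.E, (if G.i e = v then 1 else 0) * (if G.t e = w then 1 else 0)
    simp only [← ite_and, ite_mul, one_mul, zero_mul]
    rw [Finset.sum_boole, Nat.card_eq_fintype_card, Fintype.card_subtype, Nat.cast_id]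
  · ext e f
    rw [Matrix.mul_apply]
    simp only [transitionMatrix]
    refine (sum_indicator_mul_indicator _ _ _ ⟨?_, ?_⟩ ?_).symm
    · rintro ⟨v, he, hf⟩
      obtain ⟨x, rfl⟩ := exists_path e
      obtain ⟨y, rfl⟩ := exists_path f
      refine ⟨join x (G.shift.symm y) ?_, ?_, ?_⟩
      · rw [he, ← hf]; rfl
      · simp [join]
      · rfl
    · rintro ⟨x, rfl, rfl⟩
      exact ⟨_, rfl, (x.2 0).symm⟩
    · rintro v w rfl _ rfl _
      rfl

/-- A conjugacy turns the time-zero partition of the one edge shift into a second generating clopen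
Markov partition of the other. -/
theorem strongShiftEquivalent_of_conjugate {G H : FinGraph} (h : Conjugate G.shift H.shift) :
    StrongShiftEquivalent G.adjMatrix H.adjMatrix := by
  obtain ⟨Θ, hΘ⟩ := h
  have hpow : ∀ (k : ℤ) x, Θ ((G.shift ^ k) x) = (H.shift ^ k) (Θ x) := fun k x => by
    have hconj : H.shift = (Θ.symm.trans G.shift).trans Θ := by
      ext1 y; simp [hΘ]
    induction k using Int.induction_on with
    | zero => simp
    | succ k ih =>
      rw [add_comm, zpow_one_add, zpow_one_add, Homeomorph.mul_apply, Homeomorph.mul_apply, hΘ, ih]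
    | pred k ih =>
      rw [show -(k : ℤ) - 1 = -1 + -k by ring, zpow_add, zpow_add, zpow_neg_one, zpow_neg_one,
        Homeomorph.mul_apply, Homeomorph.mul_apply, ← ih]
      refine H.shift.injective ?_
      simp [← hΘ]
  let q : G.ShiftSpace → H.E := fun x => (Θ x).1 0
  have hsplice : Splices G.shift q := fun x y hxy => by
    obtain ⟨z, hz, hz'⟩ := splices_zero (Θ x) (Θ y) hxy
    refine ⟨Θ.symm z, fun k hk => ?_, fun k hk => ?_⟩
    · simpa [q, hpow] using hz k hk
    · simpa [q, hpow] using hz' k hk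
  have hgen : Generates G.shift q := fun x y hxy =>
    Θ.injective (generates_zero _ _ fun k => by simpa [q, hpow] using hxy k)
  have htrans : transitionMatrix G.shift q = transitionMatrix H.shift fun x => x.1 0 := by
    unfold transitionMatrix
    congr! 6 with a b
    rw [Θ.surjective.exists]
    simp [q, hΘ]
  have := strongShiftEquivalent_transitionMatrix splices_zero generates_zero continuous_zero
    hsplice hgen (continuous_zero.comp Θ.continuous)
  rw [htrans] at this
  exact (elementaryEquivalent_adjMatrix.strongShiftEquivalent.trans this).trans
    elementaryEquivalent_adjMatrix.strongShiftEquivalent.symm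

/-- Williams' theorem: edge shifts are conjugate exactly if their adjacency matrices are strong
shift equivalent. -/
theorem conjugate_shift_iff_strongShiftEquivalent {G H : FinGraph} :
    Conjugate G.shift H.shift ↔ StrongShiftEquivalent G.adjMatrix H.adjMatrix :=
  ⟨strongShiftEquivalent_of_conjugate, conjugate_shift_of_strongShiftEquivalent⟩

end FinGraph

/-! ### Strong equivalence to a shift of finite type -/

theorem mainTheorem4 (G : FinGraph) (S X : SmaleSpace.{u}) (hS : Conjugate S.φ G.shift) :
    (StronglyEquivalent S X ↔
      X.IsShiftOfFiniteType ∧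
        ∀ H : FinGraph, Conjugate X.φ H.shift →
          StrongShiftEquivalent G.adjMatrix H.adjMatrix) ∧
    (StronglyEquivalent S X ↔
      ∃ H : FinGraph, Conjugate X.φ H.shift ∧
        StrongShiftEquivalent G.adjMatrix H.adjMatrix) := by
  simp only [stronglyEquivalent_iff_conjugate, ← FinGraph.conjugate_shift_iff_strongShiftEquivalent]
  refine ⟨⟨fun h => ⟨⟨G, h.symm.trans hS⟩, fun H hH => (hS.symm.trans h).trans hH⟩, ?_⟩,
    ⟨fun h => ⟨G, h.symm.trans hS, ⟨Homeomorph.refl _, fun _ => rfl⟩⟩, ?_⟩⟩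
  · rintro ⟨⟨H, hH⟩, h⟩
    exact (hS.trans (h H hH)).trans hH.symm
  · rintro ⟨H, hH, h⟩
    exact (hS.trans h).trans hH.symm
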